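/- Let $p=(p_1,\dots,p_d)\in\mathbb R^d$ be a probability vector, let $X_1,X_2,\dots$ be iid random variables with values in $\{1,\dots,d\}$ and $\mathbb P(X_k=i)=p_i$, and let $\hat p_n=(\hat p_{n,1},\dots,\hat p_{n,d})$, $\hat p_{n,i}=\frac1n\sum_{k\le n}1\{X_k=i\}$, be the empirical distribution. Let $\phi$ be a real-valued function that is strictly convex on a convex set $C\subseteq\mathbb R^d$ with $p$ in its interior (for instance $C=\mathbb R^d$), differentiable in a neighbourhood of $p$ and twice differentiable at $p$. Let $D_\phi(x,y)=\phi(x)-\phi(y)-\langle\nabla\phi(y),x-y\rangle$ be its Bregman divergence (where $\phi$ or $\nabla\phi$ is not defined, arbitrary values may be used; this does not affect the limit). Put $H=\nabla^2\phi(p)$, $\Sigma=\operatorname{diag}(p)-pp^T$ (the covariance matrix of one multinomial trial) and $r=\operatorname{rank}(\Sigma^TH\Sigma)$. Then $H\Sigma$ has exactly $r$ nonzero complex eigenvalues counted with algebraic multiplicity, all of them are real, and, denoting them by $\beta_1,\dots,\beta_r$, $$n\,D_\phi(p,\hat p_n)\;\xrightarrow{d}\;\frac12\sum_{i=1}^r\beta_iZ_i^2\qquad(n\to\infty),$$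 where $Z_1,\dots,Z_r$ are independent standard Gaussian random variables. Moreover, if all $p_i>0$, then $\Sigma$ is the inverse Fisher information matrix of the family of all distributions on $\{1,\dots,d\}$: for every $i_0$, if the family is parametrized by $\theta=(p_i)_{i\ne i_0}$ via $P(\theta)$, with $P(\theta)_{i_0}=1-\sum_{i\neq i_0}\theta_i$ and $P(\theta)_i=\theta_i$ for $i\ne i_0$, then the Fisher information matrix $\mathcal I(\theta)_{ab}=-\mathbb E_\theta\big[\partial_a\partial_b\log P(\theta)_X\big]$ is invertible and $\Sigma=J\,\mathcal I(\theta)^{-1}J^T$ with $J$ the Jacobian matrix of $P$ at $\theta$. Finally, for $n\ge1$ the empirical distribution $\hat p_n$ is the maximum likelihood estimator of $p$: it is the unique maximizer of $q\mapsto\prod_{k\le n}q_{X_k}$ over all probability vectors $q$. -/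

import Mathlib

open MeasureTheory ProbabilityTheory Filter Topology

noncomputable section

/-- The Bregman divergence `D_φ(x, y) = φ(x) - φ(y) - ⟨∇φ(y), x - y⟩`. -/
def bregmanDiv {d : ℕ} (φ : EuclideanSpace ℝ (Fin d) → ℝ) (x y : EuclideanSpace ℝ (Fin d)) : ℝ :=
  φ x - φ y - inner ℝ (gradient φ y) (x - y)

/-- The Hessian matrix of `φ` at `x`: the entry `(i, j)` is the derivative of `Dφ` at `x` in the
direction `e_i`, evaluated at `e_j`. -/
def hessianMatrix {d : ℕ} (φ : EuclideanSpace ℝ (Fin d) → ℝ) (x : EuclideanSpace ℝ (Fin d)) :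
    Matrix (Fin d) (Fin d) ℝ :=
  Matrix.of fun i j =>
    fderiv ℝ (fderiv ℝ φ) x (EuclideanSpace.single i 1) (EuclideanSpace.single j 1)

/-- `p` is a probability vector. -/
def IsProbVector {d : ℕ} (p : EuclideanSpace ℝ (Fin d)) : Prop :=
  (∀ i, 0 ≤ p i) ∧ ∑ i, p i = 1

/-- The empirical distribution of the first `n` terms of a sequence with values in `Fin d`. -/
def empiricalDist {d : ℕ} (x : ℕ → Fin d) (n : ℕ) : EuclideanSpace ℝ (Fin d) :=
  WithLp.toLp 2 fun i => (1 / (n : ℝ)) * ∑ k ∈ Finset.range n, if x k = i then 1 else 0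

/-- The covariance matrix of one multinomial trial, `diag(p) - p pᵀ`. -/
def multinomialCov {d : ℕ} (p : EuclideanSpace ℝ (Fin d)) : Matrix (Fin d) (Fin d) ℝ :=
  Matrix.of fun i j => (if i = j then p i else 0) - p i * p j

/-- The likelihood of the first `n` terms of a sample `x` under the probability vector `q`. -/
def sampleLikelihood {d : ℕ} (x : ℕ → Fin d) (n : ℕ) (q : EuclideanSpace ℝ (Fin d)) : ℝ :=
  ∏ k ∈ Finset.range n, q (x k)

/-- The Fisher information matrix `I_{ab}(θ) = - E_θ [∂_a ∂_b log P_θ]` of a family `P_θ` of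
distributions on a finite set, parametrized by vectors `θ : κ → ℝ`. -/
def fisherInformation {κ ι : Type*} [Fintype κ] [DecidableEq κ] [Fintype ι]
    (P : (κ → ℝ) → ι → ℝ) (θ : κ → ℝ) : Matrix κ κ ℝ :=
  Matrix.of fun a b =>
    - ∑ x, P θ x *
      fderiv ℝ (fun θ' => fderiv ℝ (fun θ'' => Real.log (P θ'' x)) θ' (Pi.single b 1)) θ
        (Pi.single a 1)

/-- The Jacobian matrix of a map between coordinate spaces. -/
def jacobianMatrix {κ ι : Type*} [Fintype κ] [DecidableEq κ] [Fintype ι]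
    (P : (κ → ℝ) → ι → ℝ) (θ : κ → ℝ) : Matrix ι κ ℝ :=
  Matrix.of fun i a => fderiv ℝ (fun θ' => P θ' i) θ (Pi.single a 1)

/-- The family of all distributions on `Fin d`, parametrized by the probabilities of all points
except `i₀`. -/
def categoricalFamily {d : ℕ} (i₀ : Fin d) (θ : {i : Fin d // i ≠ i₀} → ℝ) : Fin d → ℝ :=
  fun i => if h : i = i₀ then 1 - ∑ j, θ j else θ ⟨i, h⟩

end

/-! With `h = x - p`, expanding `φ` and `∇φ` at `p` gives `D_φ(p, x) = ½ hᵀHh + o(‖h‖²)`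
(`bregmanDiv_isLittleO`). At `x = p̂ₙ`, scaled by `n`, the vector `√n h` is asymptotically Gaussian
with covariance `S`, and the error vanishes by the law of large numbers and Slutsky's theorem, so
the limit is a quadratic form in a Gaussian vector. Write `S = B Bᵀ` and diagonalize the symmetric
matrix `Bᵀ H B` by an orthogonal `U`. Then `W = B U` is still a root of `S`, and with `x` standard
Gaussian the limit `½ (Wx)ᵀ H (Wx)` is a weighted sum of squares. The weights are the eigenvalues of
`Bᵀ (H B)`, hence of `(H B) Bᵀ = H S`; the number of nonzero ones is `rank (Bᵀ H B) = rank (Sᵀ H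
S)`. The Fisher information claim is an explicit matrix inversion; the likelihood claim is Gibbs'
inequality. -/

/-! ### Fisher information of the categorical family. -/

lemma sum_multinomialCov_row {d : ℕ} {p : EuclideanSpace ℝ (Fin d)} (hp : ∑ i, p i = 1)
    (j : Fin d) : ∑ i, multinomialCov p i j = 0 := by
  simp [multinomialCov, Finset.sum_sub_distrib, ← Finset.sum_mul, hp]

lemma multinomialCov_transpose {d : ℕ} (p : EuclideanSpace ℝ (Fin d)) :
    (multinomialCov p).transpose = multinomialCov p := by
  ext i j
  by_cases h : i = j
  · simp [multinomialCov, h]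
  · simp [multinomialCov, h, Ne.symm h, mul_comm]

/-- The second derivative of the logarithm of a positive affine function. -/
lemma fderiv_fderiv_log_affine {E : Type*} [NormedAddCommGroup E] [NormedSpace ℝ E]
    (c : ℝ) (L : E →L[ℝ] ℝ) (x v w : E) (hx : c + L x ≠ 0) :
    fderiv ℝ (fun y => fderiv ℝ (fun z => Real.log (c + L z)) y v) x w =
      -(L v * L w / (c + L x) ^ 2) := by
  have haff (y : E) : HasFDerivAt (fun z => c + L z) L y := L.hasFDerivAt.const_add c
  have hev : ∀ᶠ y in 𝓝 x, fderiv ℝ (fun z => Real.log (c + L z)) y v = (c + L y)⁻¹ * L v := by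
    filter_upwards [(haff x).continuousAt.eventually_ne hx] with y hy
    rw [((haff y).log hy).fderiv]
    simp
  have hinv : HasFDerivAt (fun y => (c + L y)⁻¹ * L v)
      (L v • (-((c + L x) ^ 2)⁻¹) • L) x :=
    ((hasDerivAt_inv hx).comp_hasFDerivAt x (haff x)).mul_const (L v)
  rw [Filter.EventuallyEq.fderiv_eq hev, hinv.fderiv]
  simp
  ring

/-- The linear part of a coordinate of `categoricalFamily`. -/
def categoricalLinear {d : ℕ} (i₀ : Fin d) (i : Fin d) : ({i : Fin d // i ≠ i₀} → ℝ) →L[ℝ] ℝ :=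
  if h : i = i₀ then -∑ j, ContinuousLinearMap.proj j else ContinuousLinearMap.proj ⟨i, h⟩

lemma categoricalFamily_eq_affine {d : ℕ} (i₀ i : Fin d) (θ : {i : Fin d // i ≠ i₀} → ℝ) :
    categoricalFamily i₀ θ i = (if i = i₀ then 1 else 0) + categoricalLinear i₀ i θ := by
  by_cases h : i = i₀ <;> simp [categoricalFamily, categoricalLinear, h, sub_eq_add_neg]

lemma categoricalLinear_single {d : ℕ} (i₀ i : Fin d) (a : {i : Fin d // i ≠ i₀}) :
    categoricalLinear i₀ i (Pi.single a 1) =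
      (if i = a then 1 else 0) - if i = i₀ then 1 else 0 := by
  by_cases h : i = i₀
  · simp [categoricalLinear, h, a.2.symm]
  · simp [categoricalLinear, h, Pi.single_apply, Subtype.ext_iff]

lemma jacobianMatrix_categoricalFamily {d : ℕ} (i₀ : Fin d) (θ : {i : Fin d // i ≠ i₀} → ℝ) :
    jacobianMatrix (categoricalFamily i₀) θ =
      Matrix.of fun i a => categoricalLinear i₀ i (Pi.single a 1) := by
  ext i a
  have h : HasFDerivAt (fun θ' => categoricalFamily i₀ θ' i) (categoricalLinear i₀ i) θ := by
    simp_rw [categoricalFamily_eq_affine]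
    exact (categoricalLinear i₀ i).hasFDerivAt.const_add _
  simp [jacobianMatrix, h.fderiv]

/-- Each `P_i` is affine in `θ`, so `-P_i ∂_a∂_b log P_i = ∂_a P_i ∂_b P_i / P_i`. -/
lemma fisherInformation_categoricalFamily {d : ℕ} (i₀ : Fin d) (θ : {i : Fin d // i ≠ i₀} → ℝ)
    (hθ : ∀ i, categoricalFamily i₀ θ i ≠ 0) :
    fisherInformation (categoricalFamily i₀) θ =
      (jacobianMatrix (categoricalFamily i₀) θ).transpose *
        (Matrix.diagonal fun i => (categoricalFamily i₀ θ i)⁻¹) *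
        jacobianMatrix (categoricalFamily i₀) θ := by
  rw [jacobianMatrix_categoricalFamily]
  ext a b
  simp only [fisherInformation, Matrix.of_apply]
  rw [Matrix.mul_apply]
  simp only [Matrix.mul_diagonal, Matrix.transpose_apply, Matrix.of_apply]
  rw [← Finset.sum_neg_distrib]
  refine Finset.sum_congr rfl fun i _ => ?_
  have h := hθ i
  simp_rw [categoricalFamily_eq_affine i₀ i] at h ⊢
  rw [fderiv_fderiv_log_affine _ _ _ _ _ h]
  field_simp

lemma sum_ne_add {d : ℕ} (i₀ : Fin d) (f : Fin d → ℝ) :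
    ∑ a : {i : Fin d // i ≠ i₀}, f a = ∑ i, f i - f i₀ := by
  rw [← Finset.sum_subtype (Finset.univ.erase i₀) (by simp) f,
    ← Finset.add_sum_erase _ f (Finset.mem_univ i₀)]
  ring

/-- Multiplication by the Jacobian matrix of `categoricalFamily` recovers a matrix with vanishing
column sums from its rows other than `i₀`. -/
lemma jacobianMatrix_categoricalFamily_mul {d : ℕ} {κ : Type*} (i₀ : Fin d)
    (θ : {i : Fin d // i ≠ i₀} → ℝ) (M : Matrix (Fin d) κ ℝ) (hM : ∀ j, ∑ i, M i j = 0) :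
    jacobianMatrix (categoricalFamily i₀) θ *
      (M.submatrix Subtype.val id : Matrix {i : Fin d // i ≠ i₀} κ ℝ) = M := by
  rw [jacobianMatrix_categoricalFamily]
  ext i j
  simp only [Matrix.mul_apply, Matrix.of_apply, categoricalLinear_single, Matrix.submatrix_apply,
    id]
  rw [sum_ne_add i₀ fun a => ((if i = a then (1 : ℝ) else 0) - if i = i₀ then 1 else 0) * M a j]
  simp only [sub_mul, Finset.sum_sub_distrib, ite_mul, one_mul, zero_mul, Finset.sum_ite_eq,
    Finset.mem_univ, if_true]
  by_cases h : i = i₀ <;> simp [h, hM]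

/-- The inverse is the minor `K` of `S` without row and column `i₀`. Since the columns of `S` sum to
zero, `J K` restores the deleted row. Then `diag(1/p) S = 1 - 𝟙pᵀ`, and `Jᵀ` kills the constant
vector `𝟙`, which leaves the identity. -/
theorem multinomialCov_eq_inverse_fisherInformation {d : ℕ} (p : EuclideanSpace ℝ (Fin d))
    (hp : IsProbVector p) (hpos : ∀ i, 0 < p i) (i₀ : Fin d) (θ : {i : Fin d // i ≠ i₀} → ℝ)
    (hθ : ∀ j, θ j = p j) :
    categoricalFamily i₀ θ = p.ofLp ∧
      IsUnit (fisherInformation (categoricalFamily i₀) θ).det ∧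
      multinomialCov p = jacobianMatrix (categoricalFamily i₀) θ *
          (fisherInformation (categoricalFamily i₀) θ)⁻¹ *
          (jacobianMatrix (categoricalFamily i₀) θ).transpose := by
  have hfam : categoricalFamily i₀ θ = p.ofLp := by
    funext i
    by_cases h : i = i₀
    · simp [categoricalFamily, h, hθ, sum_ne_add i₀ p.ofLp, hp.2]
    · simp [categoricalFamily, h, hθ]
  set J := jacobianMatrix (categoricalFamily i₀) θ with hJ
  set S := multinomialCov p with hS
  have hrow : ∀ j, ∑ i, S i j = 0 := sum_multinomialCov_row hp.2
  set K : Matrix {i : Fin d // i ≠ i₀} {i : Fin d // i ≠ i₀} ℝ :=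
    S.submatrix Subtype.val Subtype.val with hK
  have hJS : J * K = S.submatrix id Subtype.val :=
    jacobianMatrix_categoricalFamily_mul i₀ θ (S.submatrix id Subtype.val)
      fun j => hrow (j : Fin d)
  have hFS : fisherInformation (categoricalFamily i₀) θ * K = 1 := by
    rw [fisherInformation_categoricalFamily i₀ θ (by simp [hfam, (hpos _).ne']), ← hJ,
      Matrix.mul_assoc, hJS, hfam, hJ, jacobianMatrix_categoricalFamily]
    ext a b
    have hD (i : Fin d) : (p i)⁻¹ * S i b = (if i = b then 1 else 0) - p b := by
      have := (hpos i).ne'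
      simp only [hS, multinomialCov, Matrix.of_apply]
      split_ifs <;> field_simp
      ring
    rw [Matrix.mul_apply]
    simp only [Matrix.mul_diagonal, Matrix.transpose_apply, Matrix.of_apply,
      Matrix.submatrix_apply, id, mul_assoc, hD, categoricalLinear_single]
    simp [sub_mul, Finset.sum_sub_distrib, Matrix.one_apply, Subtype.ext_iff, b.2.symm]
  refine ⟨hfam, Matrix.isUnit_det_of_right_inverse hFS, ?_⟩
  rw [Matrix.inv_eq_right_inv hFS, hJS]
  have h := jacobianMatrix_categoricalFamily_mul i₀ θ S hrow
  rw [← hJ] at h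
  have h' := congrArg Matrix.transpose h
  rw [Matrix.transpose_mul, Matrix.transpose_submatrix, multinomialCov_transpose] at h'
  exact h'.symm

/-! ### Maximum likelihood. -/

lemma empiricalDist_apply {d : ℕ} (x : ℕ → Fin d) (n : ℕ) (i : Fin d) :
    empiricalDist x n i = (∑ k ∈ Finset.range n, if x k = i then (1 : ℝ) else 0) / n := by
  simp [empiricalDist, div_eq_inv_mul]

lemma isProbVector_empiricalDist {d : ℕ} (x : ℕ → Fin d) {n : ℕ} (hn : 0 < n) :
    IsProbVector (empiricalDist x n) := by
  refine ⟨fun i => ?_, ?_⟩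
  · rw [empiricalDist_apply]
    exact div_nonneg (Finset.sum_nonneg fun k _ => by split_ifs <;> simp) n.cast_nonneg
  · simp_rw [empiricalDist_apply]
    rw [← Finset.sum_div, Finset.sum_comm]
    have : (n : ℝ) ≠ 0 := by positivity
    simp [this]

lemma empiricalDist_sample_pos {d : ℕ} (x : ℕ → Fin d) {n k : ℕ} (hk : k < n) :
    0 < empiricalDist x n (x k) := by
  rw [empiricalDist_apply]
  refine div_pos ?_ (Nat.cast_pos.2 ((Nat.zero_le k).trans_lt hk))
  refine Finset.sum_pos' (fun j _ => by split_ifs <;> simp) ⟨k, Finset.mem_range.2 hk, by simp⟩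

/-- Averages over a sample are integrals against its empirical distribution. -/
lemma sum_sample_eq_sum_empiricalDist {d : ℕ} (x : ℕ → Fin d) {n : ℕ} (hn : 0 < n)
    (f : Fin d → ℝ) :
    ∑ k ∈ Finset.range n, f (x k) = n * ∑ i, empiricalDist x n i * f i := by
  have : (n : ℝ) ≠ 0 := by positivity
  simp_rw [empiricalDist_apply, Finset.mul_sum, ← mul_assoc, mul_div_cancel₀ _ this,
    Finset.sum_mul]
  rw [Finset.sum_comm]
  simp

/-- Gibbs' inequality in product form: `t ≤ exp (t - 1)`, strict for `t ≠ 1`, is applied to every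
ratio `q / e` in the sample. -/
theorem sampleLikelihood_lt_sampleLikelihood_empiricalDist {d : ℕ} (x : ℕ → Fin d) {n : ℕ}
    (hn : 0 < n) (q : EuclideanSpace ℝ (Fin d)) (hq : IsProbVector q)
    (hne : q ≠ empiricalDist x n) :
    sampleLikelihood x n q < sampleLikelihood x n (empiricalDist x n) := by
  set e := empiricalDist x n with he
  have hpos {k : ℕ} (hk : k ∈ Finset.range n) : 0 < e (x k) :=
    empiricalDist_sample_pos x (Finset.mem_range.1 hk)
  have hprod : 0 < sampleLikelihood x n e := Finset.prod_pos fun k hk => hpos hk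
  by_cases hzero : ∃ k ∈ Finset.range n, q (x k) = 0
  · obtain ⟨k, hk, hk0⟩ := hzero
    rw [show sampleLikelihood x n q = 0 from Finset.prod_eq_zero hk hk0]
    exact hprod
  push Not at hzero
  have hqpos {k : ℕ} (hk : k ∈ Finset.range n) : 0 < q (x k) :=
    (hq.1 _).lt_of_ne' (hzero k hk)
  obtain ⟨hnonneg, hsum⟩ := isProbVector_empiricalDist x hn
  -- Equality fails only off the sample: if `e i = 0`, the left side is `0` and the right side is `q
  -- i`.
  have hle (i : Fin d) : e i * (q i / e i - 1) ≤ q i - e i := by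
    by_cases h : e i = 0
    · simp [h, hq.1 i]
    · exact (by field_simp : e i * (q i / e i - 1) = q i - e i).le
  -- If `q` agreed with `e` on the sample, then `e ≤ q` everywhere, as `e` vanishes elsewhere; equal
  -- total mass would force `q = e`.
  have hex : ∃ k ∈ Finset.range n, q (x k) ≠ e (x k) := by
    by_contra! hall
    refine hne ?_
    have hqe (i : Fin d) : e i ≤ q i := by
      by_cases hi : ∃ k ∈ Finset.range n, x k = i
      · obtain ⟨k, hk, rfl⟩ := hi
        exact (hall k hk).ge
      · push Not at hi
        rw [he, empiricalDist_apply, Finset.sum_eq_zero fun k hk => if_neg (hi k hk), zero_div]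
        exact hq.1 i
    ext i
    exact ((Finset.sum_eq_sum_iff_of_le fun i _ => hqe i).1 (hsum.trans hq.2.symm) i
      (Finset.mem_univ i)).symm
  obtain ⟨k₀, hk₀, hk₀ne⟩ := hex
  have hratio : ∏ k ∈ Finset.range n, q (x k) / e (x k) < 1 := by
    calc ∏ k ∈ Finset.range n, q (x k) / e (x k)
        < ∏ k ∈ Finset.range n, Real.exp (q (x k) / e (x k) - 1) := by
          refine Finset.prod_lt_prod (fun k hk => div_pos (hqpos hk) (hpos hk))
            (fun k _ => by linarith [Real.add_one_le_exp (q (x k) / e (x k) - 1)])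
            ⟨k₀, hk₀, ?_⟩
          have : q (x k₀) / e (x k₀) - 1 ≠ 0 := by
            rwa [sub_ne_zero, Ne, div_eq_one_iff_eq (hpos hk₀).ne']
          linarith [Real.add_one_lt_exp this]
      _ = Real.exp (n * ∑ i, e i * (q i / e i - 1)) := by
          rw [← Real.exp_sum, sum_sample_eq_sum_empiricalDist x hn fun i => q i / e i - 1]
      _ ≤ Real.exp 0 := by
          refine Real.exp_le_exp.2 (mul_nonpos_of_nonneg_of_nonpos n.cast_nonneg ?_)
          calc ∑ i, e i * (q i / e i - 1) ≤ ∑ i, (q i - e i) :=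
                Finset.sum_le_sum fun i _ => hle i
            _ = 0 := by rw [Finset.sum_sub_distrib, hq.2, hsum, sub_self]
      _ = 1 := Real.exp_zero
  rw [Finset.prod_div_distrib] at hratio
  exact (div_lt_one hprod).1 hratio

/-! ### Second-order expansion of the Bregman divergence. -/

/-- **Taylor's theorem** of order two for a function that is twice differentiable at a point. -/
lemma taylor_two_isLittleO {E : Type*} [NormedAddCommGroup E] [NormedSpace ℝ E] {f : E → ℝ} {p : E}
    (hf₁ : ∀ᶠ x in 𝓝 p, DifferentiableAt ℝ f x) (hf₂ : DifferentiableAt ℝ (fderiv ℝ f) p) :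
    (fun x => f x - f p - fderiv ℝ f p (x - p) -
      (1 / 2) * fderiv ℝ (fderiv ℝ f) p (x - p) (x - p)) =o[𝓝 p] fun x => ‖x - p‖ ^ 2 := by
  set D := fderiv ℝ (fderiv ℝ f) p with hD
  have hsymm (v w : E) : D v w = D w v :=
    second_derivative_symmetric_of_eventually_of_real
      (hf₁.mono fun x hx => hx.hasFDerivAt) hf₂.hasFDerivAt v w
  have hlin := hf₂.hasFDerivAt.isLittleO
  rw [Asymptotics.isLittleO_iff] at hlin ⊢
  intro c hc
  obtain ⟨δ, hδ, hball⟩ := Metric.eventually_nhds_iff_ball.1 (hf₁.and (hlin hc))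
  refine Metric.eventually_nhds_iff_ball.2 ⟨δ, hδ, fun x hx => ?_⟩
  have hsub : Metric.closedBall p ‖x - p‖ ⊆ Metric.ball p δ :=
    Metric.closedBall_subset_ball (by rwa [← dist_eq_norm])
  -- The derivative of the remainder is the linearization error of `Df`, by symmetry of `D`. It is
  -- at most `c‖x - p‖` on this ball, so the mean value inequality yields `c‖x - p‖²`.
  have hderiv (y : E) (hy : y ∈ Metric.closedBall p ‖x - p‖) :
      HasFDerivWithinAt (fun x => f x - f p - fderiv ℝ f p (x - p) - (1 / 2) * D (x - p) (x - p))
        (fderiv ℝ f y - fderiv ℝ f p - D (y - p)) (Metric.closedBall p ‖x - p‖) y := by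
    have hid : HasFDerivAt (fun x : E => x - p) (ContinuousLinearMap.id ℝ E) y :=
      (hasFDerivAt_id y).sub_const p
    have hquad : HasFDerivAt (fun x => D (x - p) (x - p)) _ y :=
      (D.hasFDerivAt.comp y hid).clm_apply hid
    refine ((((hball y (hsub hy)).1.hasFDerivAt.sub_const (f p)).sub
      ((fderiv ℝ f p).hasFDerivAt.comp y hid)).sub
      (hquad.const_mul (1 / 2))).hasFDerivWithinAt.congr_fderiv ?_
    ext v
    have hv := hsymm v (y - p)
    simp only [map_sub, sub_apply] at hv
    simp
    linear_combination (1 / 2) * hv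
  have hbound (y : E) (hy : y ∈ Metric.closedBall p ‖x - p‖) :
      ‖fderiv ℝ f y - fderiv ℝ f p - D (y - p)‖ ≤ c * ‖x - p‖ :=
    ((hball y (hsub hy)).2).trans <|
      mul_le_mul_of_nonneg_left (by simpa [dist_eq_norm] using hy) hc.le
  have h := (convex_closedBall p ‖x - p‖).norm_image_sub_le_of_norm_hasFDerivWithin_le hderiv
    hbound (Metric.mem_closedBall_self (norm_nonneg _))
    (by simp [dist_eq_norm] : x ∈ Metric.closedBall p ‖x - p‖)
  simpa [sq, mul_assoc] using h

/-- The gradient is taken at the moving point `x`: its linearization contributes `D(h, h)` and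
Taylor's theorem for `φ` removes `½ D(h, h)`, where `h = x - p`. -/
lemma bregmanDiv_isLittleO {d : ℕ} {φ : EuclideanSpace ℝ (Fin d) → ℝ}
    {p : EuclideanSpace ℝ (Fin d)} (hφ₁ : ∀ᶠ x in 𝓝 p, DifferentiableAt ℝ φ x)
    (hφ₂ : DifferentiableAt ℝ (fderiv ℝ φ) p) :
    (fun x => bregmanDiv φ p x - (1 / 2) * fderiv ℝ (fderiv ℝ φ) p (x - p) (x - p))
      =o[𝓝 p] fun x => ‖x - p‖ ^ 2 := by
  have hlin : (fun x => (fderiv ℝ φ x - fderiv ℝ φ p - fderiv ℝ (fderiv ℝ φ) p (x - p)) (x - p))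
      =o[𝓝 p] fun x => ‖x - p‖ ^ 2 := by
    have h := hφ₂.hasFDerivAt.isLittleO
    refine ((Asymptotics.IsBigO.of_bound 1 (.of_forall fun x => ?_)).trans_isLittleO
      (h.norm_norm.mul_isBigO (Asymptotics.isBigO_refl (fun x => ‖x - p‖) (𝓝 p)))).congr_right
      fun x => (sq _).symm
    simpa using ContinuousLinearMap.le_opNorm
      (fderiv ℝ φ x - fderiv ℝ φ p - fderiv ℝ (fderiv ℝ φ) p (x - p)) (x - p)
  refine (hlin.sub (taylor_two_isLittleO hφ₁ hφ₂)).congr_left fun x => ?_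
  have hgrad : inner ℝ (gradient φ x) (p - x) = -fderiv ℝ φ x (x - p) := by
    rw [gradient, InnerProductSpace.toDual_symm_apply, ← map_neg, neg_sub]
  simp only [bregmanDiv, hgrad, sub_apply]
  ring

lemma hessianMatrix_transpose {d : ℕ} {φ : EuclideanSpace ℝ (Fin d) → ℝ}
    {p : EuclideanSpace ℝ (Fin d)} (hφ₁ : ∀ᶠ x in 𝓝 p, DifferentiableAt ℝ φ x)
    (hφ₂ : DifferentiableAt ℝ (fderiv ℝ φ) p) :
    (hessianMatrix φ p).transpose = hessianMatrix φ p := by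
  ext i j
  exact second_derivative_symmetric_of_eventually_of_real
    (hφ₁.mono fun x hx => hx.hasFDerivAt) hφ₂.hasFDerivAt _ _

lemma fderiv_fderiv_eq_dotProduct_hessianMatrix {d : ℕ} (φ : EuclideanSpace ℝ (Fin d) → ℝ)
    (p v w : EuclideanSpace ℝ (Fin d)) :
    fderiv ℝ (fderiv ℝ φ) p v w = dotProduct v.ofLp ((hessianMatrix φ p).mulVec w.ofLp) := by
  have hdecomp (u : EuclideanSpace ℝ (Fin d)) :
      u = ∑ i, u i • EuclideanSpace.single i (1 : ℝ) := by
    ext j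
    simp [Finset.sum_apply, Pi.single_apply]
  conv_lhs => rw [hdecomp v, hdecomp w]
  simp only [map_sum, map_smul, sum_apply, smul_apply,
    smul_eq_mul, dotProduct, Matrix.mulVec, hessianMatrix, Matrix.of_apply, Finset.mul_sum]
  rw [Finset.sum_comm]
  exact Finset.sum_congr rfl fun i _ => Finset.sum_congr rfl fun j _ => by ring

/-! ### Square root of the covariance, ranks and eigenvalues. -/

/-- An explicit square root of the covariance matrix of a multinomial trial. -/
noncomputable def multinomialCovRoot {d : ℕ} (p : EuclideanSpace ℝ (Fin d)) : Matrix (Fin d) (Fin d) ℝ :=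
  Matrix.of fun i j => (if i = j then √(p i) else 0) - p i * √(p j)

/-- With `s = √p` entrywise, `B = diag(s) - p sᵀ` and `B Bᵀ = diag(p) - 2 p pᵀ + ‖s‖² p pᵀ`, where
`‖s‖² = ∑ p i = 1`. -/
lemma multinomialCovRoot_mul_transpose {d : ℕ} {p : EuclideanSpace ℝ (Fin d)}
    (hp : IsProbVector p) :
    multinomialCovRoot p * (multinomialCovRoot p).transpose = multinomialCov p := by
  ext i j
  have hsq (i : Fin d) : √(p i) * √(p i) = p i := Real.mul_self_sqrt (hp.1 i)
  have h (k : Fin d) : multinomialCovRoot p i k * multinomialCovRoot p j k =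
      (if i = k then (if j = k then p k else 0) else 0) - (if i = k then p j * p k else 0) -
        (if j = k then p i * p k else 0) + p i * p j * p k := by
    simp only [multinomialCovRoot, Matrix.of_apply]
    have := hsq k
    by_cases hi : i = k
    · subst hi
      by_cases hj : j = i
      · subst hj
        simp only [if_true]
        linear_combination (1 - 2 * p j + p j ^ 2) * this
      · simp only [hj, if_true, if_false]
        linear_combination (-p j + p i * p j) * this
    · by_cases hj : j = k
      · subst hj
        simp only [hi, if_true, if_false]
        linear_combination (-p i + p i * p j) * this
      · simp only [hi, hj, if_false]
        linear_combination (p i * p j) * this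
  simp only [Matrix.mul_apply, Matrix.transpose_apply, h, Finset.sum_add_distrib,
    Finset.sum_sub_distrib, ← Finset.mul_sum, hp.2, Finset.sum_ite_eq, Finset.mem_univ, if_true,
    multinomialCov, Matrix.of_apply]
  simp only [eq_comm (a := j)]
  split_ifs with hij
  · subst hij
    ring
  · ring

/-- The kernels agree, since `⟨Mv, B Bᵀ M v⟩ = ‖Bᵀ M v‖²`. -/
lemma rank_mul_transpose_mul {m n k : Type*} [Fintype m] [Fintype n] [Fintype k]
    [DecidableEq k] (B : Matrix m n ℝ) (M : Matrix m k ℝ) :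
    (B * B.transpose * M).rank = (B.transpose * M).rank := by
  have hker : LinearMap.ker (B * B.transpose * M).mulVecLin =
      LinearMap.ker (B.transpose * M).mulVecLin := by
    ext v
    simp only [LinearMap.mem_ker, Matrix.mulVecLin_apply]
    have := Matrix.conjTranspose_mul_self_mulVec_eq_zero B.transpose (M.mulVec v)
    simpa [Matrix.mulVec_mulVec, Matrix.conjTranspose_eq_transpose_of_trivial, ← Matrix.mul_assoc] using this
  have h₁ := (B * B.transpose * M).mulVecLin.finrank_range_add_finrank_ker
  have h₂ := (B.transpose * M).mulVecLin.finrank_range_add_finrank_ker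
  rw [hker] at h₁
  exact Nat.add_right_cancel (h₁.trans h₂.symm)

/-- One outer factor `B` is cancelled on the left, and the other after transposing. -/
lemma rank_congruence {n : Type*} [Fintype n] [DecidableEq n] {B H : Matrix n n ℝ}
    (hH : H.transpose = H) :
    ((B * B.transpose).transpose * H * (B * B.transpose)).rank =
      (B.transpose * H * B).rank := by
  have h₁ : (B * B.transpose).transpose * H * (B * B.transpose) =
      B * B.transpose * (H * B * B.transpose) := by
    simp [Matrix.transpose_mul, Matrix.mul_assoc]
  have h₂ : (B.transpose * (H * B * B.transpose)).transpose =
      B * B.transpose * (H * B) := by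
    simp [Matrix.transpose_mul, Matrix.mul_assoc, hH]
  rw [h₁, rank_mul_transpose_mul, ← Matrix.rank_transpose, h₂, rank_mul_transpose_mul,
    Matrix.mul_assoc]

/-- If `H` is symmetric, then `Bᵀ H B` can be diagonalized by replacing `B` with `B U` for an
orthogonal matrix `U`; its nonzero eigenvalues are those of `H B Bᵀ`. -/
lemma exists_diagonalization {n : Type*} [Fintype n] [DecidableEq n] (B H : Matrix n n ℝ)
    (hH : H.transpose = H) :
    ∃ (l : n → ℝ) (W : Matrix n n ℝ), W * W.transpose = B * B.transpose ∧
      W.transpose * H * W = Matrix.diagonal l ∧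
      ((H * (B * B.transpose)).map (fun t : ℝ => (t : ℂ))).charpoly.roots =
        Finset.univ.val.map (fun i => (l i : ℂ)) ∧
      Fintype.card {i // l i ≠ 0} = (B.transpose * H * B).rank := by
  have hA : (B.transpose * H * B).IsHermitian := by
    rw [Matrix.IsHermitian, Matrix.conjTranspose_eq_transpose_of_trivial]
    simp [Matrix.transpose_mul, Matrix.mul_assoc, hH]
  set U : Matrix n n ℝ := hA.eigenvectorUnitary.1 with hU
  have hUU : U * U.transpose = 1 := by
    have := Matrix.UnitaryGroup.star_mul_self hA.eigenvectorUnitary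
    rw [Matrix.star_eq_conjTranspose, Matrix.conjTranspose_eq_transpose_of_trivial] at this
    exact mul_eq_one_comm.1 this
  refine ⟨hA.eigenvalues, B * U, ?_, ?_, ?_, hA.rank_eq_card_non_zero_eigs.symm⟩
  · rw [Matrix.transpose_mul, Matrix.mul_assoc, ← Matrix.mul_assoc U, hUU, Matrix.one_mul]
  · have := hA.spectral_theorem
    have hUU' := mul_eq_one_comm.1 hUU
    have h : B.transpose * H * B = U * Matrix.diagonal hA.eigenvalues * U.transpose := by
      conv_lhs => rw [this]
      simp [Unitary.conjStarAlgAut_apply, Matrix.star_eq_conjTranspose, hU,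
        Matrix.conjTranspose_eq_transpose_of_trivial]
    calc (B * U).transpose * H * (B * U) = U.transpose * (B.transpose * H * B) * U := by
          simp only [Matrix.transpose_mul, Matrix.mul_assoc]
      _ = U.transpose * (U * Matrix.diagonal hA.eigenvalues * U.transpose) * U :=
          congrArg (U.transpose * · * U) h
      _ = (U.transpose * U) * Matrix.diagonal hA.eigenvalues * (U.transpose * U) := by
          simp only [Matrix.mul_assoc]
      _ = _ := by rw [hUU', Matrix.one_mul, Matrix.mul_one]
  · have hchar : (H * (B * B.transpose)).charpoly = (B.transpose * H * B).charpoly := by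
      rw [← Matrix.mul_assoc, Matrix.charpoly_mul_comm, ← Matrix.mul_assoc]
    have hmap : (H * (B * B.transpose)).map (fun t : ℝ => (t : ℂ)) =
        (algebraMap ℝ ℂ).mapMatrix (H * (B * B.transpose)) := rfl
    rw [hmap, RingHom.mapMatrix_apply, Matrix.charpoly_map, hchar, hA.charpoly_eq,
      Polynomial.map_prod]
    simp only [Polynomial.map_sub, Polynomial.map_X, Polynomial.map_C]
    rw [Polynomial.roots_prod _ _ (Finset.prod_ne_zero_iff.2 fun i _ => Polynomial.X_sub_C_ne_zero _)]
    simp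

/-! ### Limit theorems for the empirical distribution. -/

/-- This reduces Cramér–Wold to Lévy's continuity theorem, used for each projection at the single
frequency `1`. -/
lemma charFun_map_inner {E Ω : Type*} [NormedAddCommGroup E] [InnerProductSpace ℝ E]
    [FiniteDimensional ℝ E] [MeasurableSpace E] [BorelSpace E] [MeasurableSpace Ω]
    {μ : Measure Ω} {Y : Ω → E} (hY : AEMeasurable Y μ) (t : E) :
    charFun (μ.map fun ω => inner ℝ (Y ω) t) 1 = charFun (μ.map Y) t := by
  rw [charFun_apply_real, charFun_apply, integral_map (by fun_prop) (by fun_prop),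
    integral_map hY (by fun_prop)]
  simp

/-- The **Cramér–Wold device**. -/
theorem tendstoInDistribution_of_inner {E Ω Ω' : Type*} [NormedAddCommGroup E]
    [InnerProductSpace ℝ E] [FiniteDimensional ℝ E] [MeasurableSpace E] [BorelSpace E]
    [MeasurableSpace Ω] [MeasurableSpace Ω'] {μ : Measure Ω} [IsProbabilityMeasure μ]
    {ν : Measure Ω'} [IsProbabilityMeasure ν] {V : ℕ → Ω → E} {G : Ω' → E}
    (hV : ∀ n, AEMeasurable (V n) μ) (hG : AEMeasurable G ν)
    (h : ∀ t : E, TendstoInDistribution (fun n ω => inner ℝ (V n ω) t) atTop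
      (fun ω => inner ℝ (G ω) t) (fun _ => μ) ν) :
    TendstoInDistribution V atTop G (fun _ => μ) ν where
  forall_aemeasurable := hV
  aemeasurable_limit := hG
  tendsto := by
    refine ProbabilityMeasure.tendsto_iff_tendsto_charFun.2 fun t => ?_
    have hone := ProbabilityMeasure.tendsto_iff_tendsto_charFun.1 (h t).tendsto 1
    simpa [charFun_map_inner hG, fun n => charFun_map_inner (hV n)] using hone

lemma hasLaw_inner_stdGaussian {E : Type*} [NormedAddCommGroup E] [InnerProductSpace ℝ E]
    [FiniteDimensional ℝ E] [MeasurableSpace E] [BorelSpace E] (t : E) :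
    HasLaw (fun x => inner ℝ x t) (gaussianReal 0 (‖t‖ ^ 2).toNNReal) (stdGaussian E) where
  aemeasurable := by fun_prop
  map_eq := by
    refine Measure.ext_of_charFun (funext fun s => ?_)
    have h : charFun ((stdGaussian E).map fun x => inner ℝ x t) s =
        charFun (stdGaussian E) (s • t) := by
      rw [charFun_apply_real, charFun_apply, integral_map (by fun_prop) (by fun_prop)]
      simp [inner_smul_right]
    rw [h, charFun_stdGaussian, charFun_gaussianReal]
    simp only [norm_smul, mul_pow, Real.norm_eq_abs, Complex.ofReal_mul]
    rw [← Complex.ofReal_pow |s|, sq_abs]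
    simp
    ring_nf

section Categorical

variable {d : ℕ} {p : EuclideanSpace ℝ (Fin d)} {Ω : Type*} [MeasurableSpace Ω] {μ : Measure Ω}
  {X : ℕ → Ω → Fin d}

lemma integral_comp_categorical [IsProbabilityMeasure μ] {Y : Ω → Fin d} (hY : Measurable Y)
    (hlaw : ∀ i, μ.real (Y ⁻¹' {i}) = p i) {F : Type*} [NormedAddCommGroup F] [NormedSpace ℝ F]
    [CompleteSpace F] (f : Fin d → F) : ∫ ω, f (Y ω) ∂μ = ∑ i, p i • f i := by
  have := Measure.isProbabilityMeasure_map (μ := μ) hY.aemeasurable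
  rw [← integral_map (φ := Y) (f := f) hY.aemeasurable (by fun_prop), integral_fintype .of_finite]
  refine Finset.sum_congr rfl fun i _ => ?_
  rw [map_measureReal_apply hY (measurableSet_singleton i), hlaw]

lemma identDistrib_of_categorical [IsProbabilityMeasure μ] (hXmeas : ∀ k, Measurable (X k))
    (hXlaw : ∀ k i, μ.real (X k ⁻¹' {i}) = p i) (k l : ℕ) : IdentDistrib (X k) (X l) μ μ where
  aemeasurable_fst := (hXmeas k).aemeasurable
  aemeasurable_snd := (hXmeas l).aemeasurable
  map_eq := by
    refine Measure.ext_of_singleton fun i => ?_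
    rw [Measure.map_apply (hXmeas k) (measurableSet_singleton i),
      Measure.map_apply (hXmeas l) (measurableSet_singleton i),
      ← measureReal_eq_measureReal_iff, hXlaw, hXlaw]

lemma empiricalDist_eq_smul_sum (x : ℕ → Fin d) (n : ℕ) :
    empiricalDist x n =
      (n : ℝ)⁻¹ • ∑ k ∈ Finset.range n, EuclideanSpace.single (x k) (1 : ℝ) := by
  ext i
  simp [empiricalDist, Pi.single_apply, eq_comm]

/-- No regularity of `g` is needed, because the sample takes finitely many values. This covers the
divergence, whose `φ` is arbitrary away from `p`. -/
lemma measurable_comp_empiricalDist (hXmeas : ∀ k, Measurable (X k)) {F : Type*}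
    [MeasurableSpace F] (g : EuclideanSpace ℝ (Fin d) → F) (n : ℕ) :
    Measurable fun ω => g (empiricalDist (fun k => X k ω) n) := by
  have h : (fun ω => g (empiricalDist (fun k => X k ω) n)) =
      (fun x : Fin n → Fin d => g (WithLp.toLp 2 fun i =>
        (1 / (n : ℝ)) * ∑ k, if x k = i then 1 else 0)) ∘ fun ω k => X k ω := by
    funext ω
    simp only [empiricalDist, Function.comp_apply, Finset.sum_range]
  rw [h]
  exact (measurable_of_finite _).comp (measurable_pi_lambda _ fun k => hXmeas k)

lemma tendsto_empiricalDist [IsProbabilityMeasure μ] (hXmeas : ∀ k, Measurable (X k))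
    (hXindep : iIndepFun X μ) (hXlaw : ∀ k i, μ.real (X k ⁻¹' {i}) = p i) :
    ∀ᵐ ω ∂μ, Tendsto (fun n => empiricalDist (fun k => X k ω) n) atTop (𝓝 p) := by
  let f : Fin d → EuclideanSpace ℝ (Fin d) := fun i => EuclideanSpace.single i 1
  have hf : Measurable f := measurable_of_finite _
  have hint : Integrable (fun ω => f (X 0 ω)) μ :=
    (Integrable.of_finite (μ := μ.map (X 0)) (f := f)).comp_measurable (hXmeas 0)
  have h := strong_law_ae (fun k ω => f (X k ω)) hint
    (fun i j hij => (hXindep.indepFun hij).comp hf hf)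
    (fun i => (identDistrib_of_categorical hXmeas hXlaw i 0).comp hf)
  have hmean : ∫ ω, f (X 0 ω) ∂μ = p := by
    rw [integral_comp_categorical (hXmeas 0) (hXlaw 0)]
    ext j
    simp [f, Pi.single_apply]
  rw [hmean] at h
  filter_upwards [h] with ω hω
  simpa only [empiricalDist_eq_smul_sum] using hω

lemma dotProduct_multinomialCov_mulVec (p : EuclideanSpace ℝ (Fin d)) (t : Fin d → ℝ) :
    dotProduct t ((multinomialCov p).mulVec t) = ∑ i, p i * t i ^ 2 - (∑ i, p i * t i) ^ 2 := by
  have h (i : Fin d) : (multinomialCov p).mulVec t i = p i * t i - p i * ∑ j, p j * t j := by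
    simp [Matrix.mulVec, dotProduct, multinomialCov, sub_mul, Finset.sum_sub_distrib,
      Finset.mul_sum, mul_assoc]
  simp only [dotProduct, h, mul_sub, Finset.sum_sub_distrib, sq]
  rw [Finset.sum_mul]
  exact congrArg₂ _ (Finset.sum_congr rfl fun i _ => by ring)
    (Finset.sum_congr rfl fun i _ => by ring)

/-- The **multivariate central limit theorem** for the empirical distribution. -/
theorem tendstoInDistribution_empiricalDist [IsProbabilityMeasure μ]
    (hXmeas : ∀ k, Measurable (X k)) (hXindep : iIndepFun X μ)
    (hXlaw : ∀ k i, μ.real (X k ⁻¹' {i}) = p i) (W : Matrix (Fin d) (Fin d) ℝ)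
    (hW : W * W.transpose = multinomialCov p) :
    TendstoInDistribution
      (fun (n : ℕ) ω => √n • (empiricalDist (fun k => X k ω) n - p)) atTop
      (fun x : EuclideanSpace ℝ (Fin d) => WithLp.toLp 2 (W.mulVec x.ofLp)) (fun _ => μ)
      (stdGaussian (EuclideanSpace ℝ (Fin d))) := by
  have hGcont : Continuous fun x : EuclideanSpace ℝ (Fin d) => WithLp.toLp 2 (W.mulVec x.ofLp) :=
    (PiLp.continuous_toLp 2 _).comp
      (continuous_const.matrix_mulVec (PiLp.continuous_ofLp 2 _))
  refine tendstoInDistribution_of_inner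
    (fun n => (measurable_comp_empiricalDist hXmeas (fun q => √n • (q - p)) n).aemeasurable)
    hGcont.measurable.aemeasurable fun t => ?_
  have ht : Measurable t.ofLp := measurable_of_finite _
  have hmean : ∫ ω, t (X 0 ω) ∂μ = ∑ i, p i * t i :=
    integral_comp_categorical (hXmeas 0) (hXlaw 0) t.ofLp
  have hL2 : MemLp (fun ω => t (X 0 ω)) 2 μ :=
    MemLp.of_bound (ht.comp (hXmeas 0)).aestronglyMeasurable (∑ i, ‖t i‖)
      (.of_forall fun ω => Finset.single_le_sum (f := fun i => ‖t i‖)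
        (fun _ _ => norm_nonneg _) (Finset.mem_univ _))
  -- Both sides are `tᵀ S t`; the right one is the variance of `⟨Wx, t⟩ = ⟨x, Wᵀt⟩` for standard
  -- Gaussian `x`.
  have hvar : Var[fun ω => t (X 0 ω); μ] = ‖WithLp.toLp 2 (W.transpose.mulVec t.ofLp)‖ ^ 2 := by
    have hsq : ∫ ω, t (X 0 ω) ^ 2 ∂μ = ∑ i, p i * t i ^ 2 :=
      integral_comp_categorical (hXmeas 0) (hXlaw 0) fun i => t i ^ 2
    have hnorm : ‖WithLp.toLp 2 (W.transpose.mulVec t.ofLp)‖ ^ 2 =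
        dotProduct t.ofLp ((multinomialCov p).mulVec t.ofLp) := by
      rw [← hW, ← Matrix.mulVec_mulVec, Matrix.dotProduct_mulVec, ← Matrix.mulVec_transpose,
        EuclideanSpace.real_norm_sq_eq]
      simp [dotProduct, sq]
    rw [variance_eq_sub hL2, hnorm, dotProduct_multinomialCov_mulVec]
    simp only [Pi.pow_apply]
    rw [hsq, hmean]
  have hlaw : HasLaw (fun x : EuclideanSpace ℝ (Fin d) =>
      inner ℝ (WithLp.toLp 2 (W.mulVec x.ofLp)) t)
      (gaussianReal 0 Var[fun ω => t (X 0 ω); μ].toNNReal)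
      (stdGaussian (EuclideanSpace ℝ (Fin d))) := by
    rw [hvar]
    convert hasLaw_inner_stdGaussian (WithLp.toLp 2 (W.transpose.mulVec t.ofLp)) using 2 with x
    simp only [EuclideanSpace.inner_eq_star_dotProduct, star_trivial]
    rw [Matrix.dotProduct_mulVec, Matrix.mulVec_transpose]
  have h := tendstoInDistribution_inv_sqrt_mul_sum_sub (X := fun k ω => t (X k ω)) hlaw hL2
    (hXindep.comp (fun _ => t.ofLp) fun _ => ht)
    (fun k => (identDistrib_of_categorical hXmeas hXlaw k 0).comp ht)
  refine h.congr (fun n => .of_forall fun ω => ?_) (.of_forall fun _ => rfl)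
  rcases Nat.eq_zero_or_pos n with rfl | hn
  · simp
  have hn' : (0 : ℝ) < n := Nat.cast_pos.2 hn
  have hs : √(n : ℝ) ≠ 0 := (Real.sqrt_pos.2 hn').ne'
  have hss : √(n : ℝ) * √n = n := Real.mul_self_sqrt hn'.le
  have hinner : inner ℝ (empiricalDist (fun k => X k ω) n) t =
      (n : ℝ)⁻¹ * ∑ k ∈ Finset.range n, t (X k ω) := by
    rw [sum_sample_eq_sum_empiricalDist (fun k => X k ω) hn t.ofLp, inv_mul_cancel_left₀ hn'.ne',
      PiLp.inner_apply]
    simp [mul_comm]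
  have hpt : inner ℝ p t = ∑ i, p i * t i := by
    rw [PiLp.inner_apply]
    simp [mul_comm]
  simp only [inner_smul_left, inner_sub_left, hinner, hpt, hmean]
  simp only [conj_trivial]
  field_simp
  rw [sq, hss]

end Categorical

/-! ### The limit law and the main theorem. -/

lemma map_univ_equiv_subtype {α β : Type*} [Fintype α] [Fintype β] {P : α → Prop}
    [DecidablePred P] (e : β ≃ {a // P a}) :
    Finset.univ.map (e.toEmbedding.trans (Function.Embedding.subtype P)) =
      Finset.univ.filter P := by
  ext a
  simp only [Finset.mem_map, Finset.mem_univ, true_and, Finset.mem_filter]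
  exact ⟨fun ⟨j, hj⟩ => hj ▸ (e j).2, fun ha => ⟨e.symm ⟨a, ha⟩, by simp⟩⟩

/-- A weighted sum of squares of standard Gaussian variables only depends on the nonzero weights. -/
lemma identDistrib_weighted_sum_sq {d r : ℕ} (l : Fin d → ℝ) (e : Fin r ≃ {i : Fin d // l i ≠ 0})
    {Ω' : Type*} [MeasurableSpace Ω'] {ν : Measure Ω'} [IsProbabilityMeasure ν]
    {Z : Fin r → Ω' → ℝ} (hZindep : iIndepFun Z ν)
    (hZlaw : ∀ i, HasLaw (Z i) (gaussianReal 0 1) ν) :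
    IdentDistrib (fun x : EuclideanSpace ℝ (Fin d) => (1 / 2 : ℝ) * ∑ i, l i * x i ^ 2)
      (fun ω => (1 / 2 : ℝ) * ∑ j, l (e j) * Z j ω ^ 2)
      (stdGaussian (EuclideanSpace ℝ (Fin d))) ν := by
  set γ := Measure.pi fun _ : Fin d => gaussianReal 0 1 with hγ
  have hcoord : HasLaw (fun (x : Fin d → ℝ) (j : Fin r) => x (e j))
      (Measure.pi fun _ => gaussianReal 0 1) γ := by
    refine iIndepFun.hasLaw_pi (fun j => (measurePreserving_eval (fun _ : Fin d => gaussianReal 0 1) (e j : Fin d)).hasLaw) ?_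
    have h : iIndepFun (fun (i : Fin d) (x : Fin d → ℝ) => x i) γ :=
      iIndepFun_pi (X := fun _ => id) fun _ => aemeasurable_id
    exact h.precomp (g := fun j : Fin r => (e j : Fin d))
      (Subtype.val_injective.comp e.injective)
  have hZ := hZindep.hasLaw_pi hZlaw
  have hid : IdentDistrib (fun (x : Fin d → ℝ) (j : Fin r) => x (e j)) (fun ω j => Z j ω) γ ν :=
    ⟨hcoord.aemeasurable, hZ.aemeasurable, hcoord.map_eq.trans hZ.map_eq.symm⟩
  have hg : Measurable fun y : Fin r → ℝ => (1 / 2 : ℝ) * ∑ j, l (e j) * y j ^ 2 := by fun_prop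
  have hsum (x : Fin d → ℝ) : ∑ j, l (e j) * x (e j) ^ 2 = ∑ i, l i * x i ^ 2 := by
    rw [← Finset.sum_filter_of_ne (p := fun i => l i ≠ 0) fun i _ hi => left_ne_zero_of_mul hi,
      ← map_univ_equiv_subtype e, Finset.sum_map]
    rfl
  have h := hid.comp hg
  refine ⟨by fun_prop, h.aemeasurable_snd, ?_⟩
  rw [← map_pi_eq_stdGaussian, Measure.map_map (by fun_prop) (by fun_prop)]
  refine Eq.trans ?_ h.map_eq
  congr 1
  funext x
  simp [← hsum]

/-- Slutsky: `√n (p̂ₙ - p)` converges in law jointly with the relative error `g(p̂ₙ) → 0`, and `n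
D_φ(p, p̂ₙ)` is a continuous function of this pair. -/
theorem tendstoInDistribution_bregmanDiv {d : ℕ} {p : EuclideanSpace ℝ (Fin d)} {Ω : Type*}
    [MeasurableSpace Ω] {μ : Measure Ω} [IsProbabilityMeasure μ] {X : ℕ → Ω → Fin d}
    (hXmeas : ∀ k, Measurable (X k)) (hXindep : iIndepFun X μ)
    (hXlaw : ∀ k i, μ.real (X k ⁻¹' {i}) = p i) {φ : EuclideanSpace ℝ (Fin d) → ℝ}
    (hφ₁ : ∀ᶠ x in 𝓝 p, DifferentiableAt ℝ φ x) (hφ₂ : DifferentiableAt ℝ (fderiv ℝ φ) p)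
    {W : Matrix (Fin d) (Fin d) ℝ} (hW : W * W.transpose = multinomialCov p) {l : Fin d → ℝ}
    (hl : W.transpose * hessianMatrix φ p * W = Matrix.diagonal l) :
    TendstoInDistribution
      (fun (n : ℕ) (ω : Ω) => (n : ℝ) * bregmanDiv φ p (empiricalDist (fun k => X k ω) n)) atTop
      (fun x : EuclideanSpace ℝ (Fin d) => (1 / 2 : ℝ) * ∑ i, l i * x i ^ 2) (fun _ => μ)
      (stdGaussian (EuclideanSpace ℝ (Fin d))) := by
  set D := fderiv ℝ (fderiv ℝ φ) p with hD
  -- At `x = p` the quotient is `0 / 0 = 0`, so `g → 0` along the full neighbourhood filter, even if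
  -- `p̂ₙ = p`.
  set g : EuclideanSpace ℝ (Fin d) → ℝ := fun x =>
    (bregmanDiv φ p x - (1 / 2) * D (x - p) (x - p)) / ‖x - p‖ ^ 2 with hg
  have hg0 : Tendsto g (𝓝 p) (𝓝 0) := (bregmanDiv_isLittleO hφ₁ hφ₂).tendsto_div_nhds_zero
  have hgmul (x : EuclideanSpace ℝ (Fin d)) :
      bregmanDiv φ p x = (1 / 2) * D (x - p) (x - p) + g x * ‖x - p‖ ^ 2 := by
    by_cases h : x = p
    · simp [h, bregmanDiv]
    · have : ‖x - p‖ ≠ 0 := norm_ne_zero_iff.2 (sub_ne_zero.2 h)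
      simp only [hg]
      field_simp
      ring
  have hgmeas (n : ℕ) : Measurable fun ω => g (empiricalDist (fun k => X k ω) n) :=
    measurable_comp_empiricalDist hXmeas g n
  have hrem : TendstoInMeasure μ (fun n ω => g (empiricalDist (fun k => X k ω) n)) atTop
      fun _ => 0 := by
    refine tendstoInMeasure_of_tendsto_ae (fun n => (hgmeas n).aestronglyMeasurable) ?_
    filter_upwards [tendsto_empiricalDist hXmeas hXindep hXlaw] with ω hω
    exact hg0.comp hω
  have hcont : Continuous fun z : EuclideanSpace ℝ (Fin d) × ℝ =>
      (1 / 2) * D z.1 z.1 + z.2 * ‖z.1‖ ^ 2 := by fun_prop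
  have h := (tendstoInDistribution_empiricalDist hXmeas hXindep hXlaw W
    hW).continuous_comp_prodMk_of_tendstoInMeasure_const hcont hrem
      fun n => (hgmeas n).aemeasurable
  refine h.congr (fun n => .of_forall fun ω => ?_) (.of_forall fun x => ?_)
  · have hss : √(n : ℝ) * √n = n := Real.mul_self_sqrt n.cast_nonneg
    simp only [hgmul, norm_smul, mul_pow, map_smul, smul_apply, smul_eq_mul, Real.norm_eq_abs,
      sq_abs, sq (√(n : ℝ)), hss]
    linear_combination
      (1 / 2) * (D (empiricalDist (fun k => X k ω) n - p) (empiricalDist (fun k => X k ω) n - p))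
        * hss
  · have hquad : dotProduct (W.mulVec x.ofLp) ((hessianMatrix φ p).mulVec (W.mulVec x.ofLp)) =
        dotProduct x.ofLp ((Matrix.diagonal l).mulVec x.ofLp) := by
      rw [← hl, ← Matrix.mulVec_mulVec, ← Matrix.mulVec_mulVec, Matrix.dotProduct_mulVec x.ofLp,
        Matrix.vecMul_transpose]
    simp only [hD, fderiv_fderiv_eq_dotProduct_hessianMatrix, hquad, zero_mul, add_zero]
    simp only [dotProduct, Matrix.mulVec_diagonal]
    exact congrArg _ (Finset.sum_congr rfl fun i _ => by ring)

theorem mainTheorem4 {d : ℕ}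
    -- the true distribution and the observations, an iid sequence with that distribution
    (p : EuclideanSpace ℝ (Fin d)) (hp : IsProbVector p)
    {Ω : Type*} [MeasurableSpace Ω] (μ : Measure Ω) [IsProbabilityMeasure μ]
    (X : ℕ → Ω → Fin d) (hXmeas : ∀ k, Measurable (X k)) (hXindep : iIndepFun X μ)
    (hXlaw : ∀ k i, μ.real (X k ⁻¹' {i}) = p i)
    -- a strictly convex function that is twice differentiable at `p`
    (φ : EuclideanSpace ℝ (Fin d) → ℝ) (C : Set (EuclideanSpace ℝ (Fin d)))
    (hφconv : StrictConvexOn ℝ C φ) (hpC : p ∈ interior C)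
    (hφ₁ : ∀ᶠ x in 𝓝 p, DifferentiableAt ℝ φ x)
    (hφ₂ : DifferentiableAt ℝ (fderiv ℝ φ) p)
    -- the Hessian, the covariance matrix and the rank
    (H S : Matrix (Fin d) (Fin d) ℝ) (hH : H = hessianMatrix φ p) (hS : S = multinomialCov p)
    (r : ℕ) (hr : r = (S.transpose * H * S).rank)
    -- independent standard Gaussian variables
    {Ω' : Type*} [MeasurableSpace Ω'] (ν : Measure Ω') [IsProbabilityMeasure ν]
    (Z : Fin r → Ω' → ℝ) (hZindep : iIndepFun Z ν)
    (hZlaw : ∀ i, HasLaw (Z i) (gaussianReal 0 1) ν) :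
    -- convergence in distribution; the `β i` are the nonzero eigenvalues of `H * S`,
    -- counted with algebraic multiplicity, and all of these are real
    (∃ β : Fin r → ℝ,
      ((H * S).map (fun t : ℝ => (t : ℂ))).charpoly.roots.filter (fun z => z ≠ 0) =
        Finset.univ.val.map (fun i => (β i : ℂ)) ∧
      TendstoInDistribution
        (fun (n : ℕ) (ω : Ω) => (n : ℝ) * bregmanDiv φ p (empiricalDist (fun k => X k ω) n))
        atTop (fun ω' => (1 / 2 : ℝ) * ∑ i, β i * Z i ω' ^ 2) (fun _ => μ) ν) ∧
    -- if all `p i` are positive, `S` is the inverse Fisher information: for each choice of the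
    -- eliminated coordinate, it is the inverse Fisher matrix of the free coordinates, transported
    -- to `ℝ^d` by the Jacobian of the parametrization
    ((∀ i, 0 < p i) → ∀ (i₀ : Fin d) (θ : {i : Fin d // i ≠ i₀} → ℝ), (∀ j, θ j = p j) →
      categoricalFamily i₀ θ = p.ofLp ∧
      IsUnit (fisherInformation (categoricalFamily i₀) θ).det ∧
      S = jacobianMatrix (categoricalFamily i₀) θ *
          (fisherInformation (categoricalFamily i₀) θ)⁻¹ *
          (jacobianMatrix (categoricalFamily i₀) θ).transpose) ∧
    -- the empirical distribution is the maximum likelihood estimator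
    (∀ (n : ℕ) (ω : Ω), 0 < n →
      IsProbVector (empiricalDist (fun k => X k ω) n) ∧
      ∀ q : EuclideanSpace ℝ (Fin d), IsProbVector q → q ≠ empiricalDist (fun k => X k ω) n →
        sampleLikelihood (fun k => X k ω) n q <
          sampleLikelihood (fun k => X k ω) n (empiricalDist (fun k => X k ω) n)) := by
  have hHsymm : H.transpose = H := hH ▸ hessianMatrix_transpose hφ₁ hφ₂
  have hroot : multinomialCovRoot p * (multinomialCovRoot p).transpose = S :=
    (multinomialCovRoot_mul_transpose hp).trans hS.symm
  obtain ⟨l, W, hW, hdiag, hroots, hcard⟩ := exists_diagonalization (multinomialCovRoot p) H hHsymm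
  have hr' : Fintype.card {i // l i ≠ 0} = r := by
    rw [hcard, hr, ← hroot, rank_congruence hHsymm]
  rw [hroot] at hW hroots
  let e : Fin r ≃ {i // l i ≠ 0} := (Fintype.equivFinOfCardEq hr').symm
  refine ⟨⟨fun j => l (e j), ?_, ?_⟩, ?_, ?_⟩
  · rw [hroots, Multiset.filter_map]
    have h := congrArg (fun s => s.val.map fun i => (l i : ℂ)) (map_univ_equiv_subtype e)
    simp only [Finset.map_val, Finset.filter_val, Multiset.map_map] at h
    simp only [Function.comp_def, Complex.ofReal_eq_zero, ne_eq] at h ⊢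
    exact h.symm
  · have h := tendstoInDistribution_bregmanDiv hXmeas hXindep hXlaw hφ₁ hφ₂ (hW.trans hS)
      (hH ▸ hdiag)
    -- Convergence in distribution sees only the law of the limit, so the Gaussian vector on `ℝ^d`
    -- may be replaced by the given `Z`.
    have hid := identDistrib_weighted_sum_sq l e hZindep hZlaw
    refine ⟨h.forall_aemeasurable, hid.aemeasurable_snd, ?_⟩
    have := h.tendsto
    simp_rw [hid.map_eq] at this
    exact this
  · intro hpos i₀ θ hθ
    rw [hS]
    exact multinomialCov_eq_inverse_fisherInformation p hp hpos i₀ θ hθ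
  · exact fun n ω hn => ⟨isProbVector_empiricalDist _ hn, fun q hq hne =>
      sampleLikelihood_lt_sampleLikelihood_empiricalDist _ hn q hq hne⟩
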